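/- Every real tree with countably many vertices is an asymptotic subcone of the hyperbolic plane. Here a geodesic segment joining two points $x,y$ of a metric space $T$ is the image of an isometric inclusion $g:[0,a]\to T$ with $a=d_T(x,y)$, $g(0)=x$, $g(a)=y$, and $T$ is geodesic if any two of its points are joined by a geodesic segment. A metric space is a real tree if (1) any two distinct points are joined by a unique geodesic segment, and (2) whenever two geodesic segments $[a,b]$, $[b,c]$ have only the point $b$ in common, their union is a geodesic segment (from $a$ to $c$). A vertex of a real tree is a branch point, i.e. a point from which at least three nondegenerate geodesic segments issue that pairwise have only this point in common (so countability of any larger set, such as the set of all branch points and end points, is also sufficient); "countably many" includes finitely many or none. A metric space $T$ is an asymptotic subcone of an unbounded metric space $X$ if $T$ is geodesic and for every finite subset $F\subseteq T$ there are positive numbers $\varepsilon_i\to 0$ and, for every $t\in F$, a sequence $(x_t^i)_{i}$ of points of $X$ such that $$\lim_{i\to\infty}\varepsilon_i\, d_X(x_{t_1}^i,x_{t_2}^i)=d_T(t_1,t_2)\qquad\text{for all } t_1,t_2\in F.$$ The hyperbolic plane is taken with its metric of curvature $-1$. -/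

import Mathlib

open Filter Topology

universe u v

/-- The set `s` is (the image of) a geodesic segment from `x` to `y`: there is an isometric
inclusion `g : [0, a] → T`, `a = dist x y`, with `g 0 = x`, `g a = y` and image `s`. The values of
the total function `g` outside of `[0, a]` play no role. -/
def IsGeodesicSegment {T : Type u} [MetricSpace T] (x y : T) (s : Set T) : Prop :=
  ∃ g : ℝ → T,
    (∀ p ∈ Set.Icc (0 : ℝ) (dist x y), ∀ q ∈ Set.Icc (0 : ℝ) (dist x y),
      dist (g p) (g q) = |p - q|) ∧
    g 0 = x ∧ g (dist x y) = y ∧ g '' Set.Icc (0 : ℝ) (dist x y) = s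

/-- A geodesic metric space: any two points are joined by a geodesic segment. -/
def IsGeodesicSpace (T : Type u) [MetricSpace T] : Prop :=
  ∀ x y : T, ∃ s : Set T, IsGeodesicSegment x y s

/-- A real tree: two distinct points are joined by a unique geodesic segment, and if two geodesic
segments `[a, b]` and `[b, c]` have only `b` in common, then their union is a geodesic segment
(necessarily one from `a` to `c`). -/
structure IsRealTree (T : Type u) [MetricSpace T] : Prop where
  existsUnique_segment : ∀ x y : T, x ≠ y → ∃! s : Set T, IsGeodesicSegment x y s
  union_segment : ∀ (a b c : T) (s t : Set T), IsGeodesicSegment a b s → IsGeodesicSegment b c t →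
    s ∩ t = {b} → IsGeodesicSegment a c (s ∪ t)

/-- The vertices of a real tree, understood as its branch points: the points from which there
issue (at least) three nondegenerate geodesic segments that pairwise have only this point in
common. (If the end points of the tree, or further points, are counted as vertices as well, then
the set of vertices only gets larger, so that its countability is a stronger condition than the
countability of the present set.) -/
def realTreeVertices (T : Type u) [MetricSpace T] : Set T :=
  {x | ∃ (y : Fin 3 → T) (s : Fin 3 → Set T),
    (∀ i, y i ≠ x ∧ IsGeodesicSegment x (y i) (s i)) ∧ ∀ i j, i ≠ j → s i ∩ s j = {x}}

/-- `T` can be isometrically embedded at infinity into the (unbounded) metric space `X`: there are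
positive `ε i → 0` and for every `t : T` a sequence `x t` in `X` such that the normalized distances
`ε i * dist (x t₁ i) (x t₂ i)` tend to `dist t₁ t₂`. -/
def IsometricallyEmbedsAtInfinity (T : Type u) [MetricSpace T] (X : Type v) [MetricSpace X] :
    Prop :=
  ∃ ε : ℕ → ℝ, (∀ i, 0 < ε i) ∧ Tendsto ε atTop (𝓝 0) ∧
    ∃ x : T → ℕ → X, ∀ t₁ t₂ : T,
      Tendsto (fun i => ε i * dist (x t₁ i) (x t₂ i)) atTop (𝓝 (dist t₁ t₂))

/-- `T` is an asymptotic subcone of the (unbounded) metric space `X`: it is geodesic and each of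
its finite subsets, with the induced metric, embeds isometrically at infinity into `X`. -/
structure IsAsymptoticSubcone (T : Type u) [MetricSpace T] (X : Type v) [MetricSpace X] :
    Prop where
  isGeodesicSpace : IsGeodesicSpace T
  finite_embeds : ∀ F : Set T, F.Finite → IsometricallyEmbedsAtInfinity (↥F) X

/-! ### Finite ultrametric configurations in the upper half plane -/

/-! A real tree is 0-hyperbolic: Gromov products `h s t` at a base point `p` satisfy `min (h s r) (h
r t) ≤ h s t` (`min_gromovProduct_le`), because `h s t` is the level at which the geodesics from `p`
to `s` and `t` part. For finitely many points such data are realized in the half plane at scale `r`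
(`exists_upperHalfPlane_of_ultrametric`): the height of `s` is `exp (-r * h s s)`, and abscissae of
`s` and `t` differ by `O(exp (-r * h s t))`. Then `cosh` of the distance grows like a positive
multiple of `exp (r * (h s s + h t t - 2 * h s t))`, whose exponent is `r * dist s t`. -/

theorem exists_weight_sum_injective (ι : Type*) [Finite ι] :
    ∃ c : ι → ℝ, Function.Injective fun A : Finset ι => ∑ i ∈ A, c i := by
  obtain ⟨n, ⟨e⟩⟩ := Finite.exists_equiv_fin ι
  let f : ι ↪ ℕ := e.toEmbedding.trans Fin.valEmbedding
  refine ⟨fun i => (2 : ℝ) ^ f i, fun A B h => ?_⟩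
  have key : ∑ i ∈ A.map f, 2 ^ i = ∑ i ∈ B.map f, 2 ^ i := by
    rw [Finset.sum_map, Finset.sum_map]
    beta_reduce at h
    exact_mod_cast h
  exact Finset.map_injective f (Finset.geomSum_injective le_rfl key)

theorem tendsto_exp_neg_mul_atTop {a : ℝ} (ha : 0 ≤ a) :
    Tendsto (fun r : ℝ => Real.exp (-(r * a))) atTop (𝓝 (if a = 0 then 1 else 0)) := by
  split_ifs with h
  · simp [h]
  · exact Real.tendsto_exp_atBot.comp (tendsto_neg_atTop_atBot.comp
      (tendsto_id.atTop_mul_const (lt_of_le_of_ne ha (Ne.symm h))))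

/-- If `cosh (D r)` grows like a positive multiple of `exp (r * d)`, then `D r` grows like
`r * d`. -/
theorem tendsto_div_of_tendsto_cosh {D : ℝ → ℝ} {d L : ℝ} (hD : ∀ r, 0 ≤ D r) (hL : 0 < L)
    (h : Tendsto (fun r => Real.cosh (D r) * Real.exp (-(r * d))) atTop (𝓝 L)) :
    Tendsto (fun r => r⁻¹ * D r) atTop (𝓝 d) := by
  have hlog : Tendsto (fun r => Real.log (Real.cosh (D r)) - r * d) atTop (𝓝 (Real.log L)) := by
    refine (h.log hL.ne').congr fun r => ?_
    rw [Real.log_mul (Real.cosh_pos _).ne' (Real.exp_pos _).ne', Real.log_exp]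
    ring
  have hinv : Tendsto (fun r : ℝ => r⁻¹) atTop (𝓝 0) := tendsto_inv_atTop_zero
  have hmain : Tendsto (fun r => r⁻¹ * Real.log (Real.cosh (D r))) atTop (𝓝 d) := by
    have := (hinv.mul hlog).add_const d
    rw [zero_mul, zero_add] at this
    refine this.congr' ?_
    filter_upwards [eventually_gt_atTop 0] with r hr
    field_simp
    ring
  have hupper : Tendsto (fun r => r⁻¹ * Real.log (Real.cosh (D r)) + r⁻¹ * Real.log 2) atTop
      (𝓝 d) := by
    simpa using hmain.add (hinv.mul_const (Real.log 2))
  -- For `D ≥ 0`, `exp D / 2 ≤ cosh D ≤ exp D`, so `D` and `log (cosh D)` differ by at most `log 2`.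
  refine tendsto_of_tendsto_of_tendsto_of_le_of_le' hmain hupper ?_ ?_
  · filter_upwards [eventually_gt_atTop 0] with r hr
    refine mul_le_mul_of_nonneg_left ?_ (inv_pos.2 hr).le
    rw [Real.log_le_iff_le_exp (Real.cosh_pos _), Real.cosh_eq]
    have : Real.exp (-D r) ≤ Real.exp (D r) := Real.exp_le_exp.2 (by linarith [hD r])
    linarith
  · filter_upwards [eventually_gt_atTop 0] with r hr
    rw [← mul_add]
    refine mul_le_mul_of_nonneg_left ?_ (inv_pos.2 hr).le
    rw [← Real.log_mul (Real.cosh_pos _).ne' two_ne_zero,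
      Real.le_log_iff_exp_le (mul_pos (Real.cosh_pos _) two_pos), Real.cosh_eq]
    linarith [Real.exp_pos (-D r)]

/-- A finite family of heights and merging levels `h`, satisfying the ultrametric inequality, is
realized asymptotically in the upper half plane. -/
theorem exists_upperHalfPlane_of_ultrametric {ι : Type*} [Finite ι] (h : ι → ι → ℝ)
    (hsymm : ∀ s t, h s t = h t s) (hultra : ∀ s r t, min (h s r) (h r t) ≤ h s t) :
    ∃ z : ι → ℝ → UpperHalfPlane, ∀ s t,
      Tendsto (fun r => r⁻¹ * dist (z s r) (z t r)) atTop
        (𝓝 (h s s + h t t - 2 * h s t)) := by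
  classical
  cases nonempty_fintype ι
  obtain ⟨c, hc⟩ := exists_weight_sum_injective ι
  let X : ι → ℝ → ℝ := fun s r => ∑ t, c t * Real.exp (-(r * h s t))
  refine ⟨fun s r => ⟨⟨X s r, Real.exp (-(r * h s s))⟩, Real.exp_pos _⟩, fun s t => ?_⟩
  have hle : ∀ s t, h s t ≤ h s s := fun s t => by
    simpa [hsymm t s] using hultra s t s
  set g := h s t with hg
  have hgs : 0 ≤ h s s - g := sub_nonneg.2 (hle s t)
  have hgt : 0 ≤ h t t - g := sub_nonneg.2 (by rw [hg, hsymm]; exact hle t s)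
  let A : Finset ι := {u | g < h s u}
  let B : Finset ι := {u | g < h t u}
  have hX : Tendsto (fun r => (X s r - X t r) * Real.exp (r * g)) atTop
      (𝓝 (∑ u ∈ B, c u - ∑ u ∈ A, c u)) := by
    have hterm : ∀ u ∈ (Finset.univ : Finset ι),
        Tendsto (fun r => c u * (Real.exp (-(r * (h s u - g))) - Real.exp (-(r * (h t u - g)))))
          atTop (𝓝 ((if g < h t u then c u else 0) - if g < h s u then c u else 0)) := by
      intro u _
      have h1 := hultra s u t
      have h2 := hultra s t u
      have h3 := hultra t s u
      rw [hsymm u t, ← hg] at h1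
      rw [← hg] at h2
      rw [hsymm t s, ← hg] at h3
      -- If `u` leaves `s` below level `g`, it leaves `t` at the same level and its terms cancel.
      -- Otherwise both levels are at least `g`, and only those equal to `g` survive the rescaling.
      by_cases hu : h s u < g
      · have h4 : h t u = h s u := by grind
        simp [h4]
      · have h4 : g ≤ h t u := by grind
        have h5 := (tendsto_exp_neg_mul_atTop (sub_nonneg.2 (not_lt.1 hu))).sub
          (tendsto_exp_neg_mul_atTop (sub_nonneg.2 h4))
        convert h5.const_mul (c u) using 2
        grind
    have := tendsto_finsetSum _ hterm
    rw [Finset.sum_sub_distrib, ← Finset.sum_filter, ← Finset.sum_filter] at this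
    refine this.congr fun r => ?_
    simp only [X]
    rw [← Finset.sum_sub_distrib, Finset.sum_mul]
    refine Finset.sum_congr rfl fun u _ => ?_
    rw [← mul_sub, mul_assoc, sub_mul, ← Real.exp_add, ← Real.exp_add]
    congr 3 <;> ring_nf
  have hlim := (((hX.pow 2).add (tendsto_exp_neg_mul_atTop
    (mul_nonneg two_pos.le hgs))).add (tendsto_exp_neg_mul_atTop
    (mul_nonneg two_pos.le hgt))).div_const 2
  refine tendsto_div_of_tendsto_cosh (fun r => dist_nonneg) ?_ (hlim.congr fun r => ?_)
  -- The limit is positive: if both heights exceed `g`, then `s` lies in `A` but not in `B`, and the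
  -- weights `c` separate distinct subsets.
  · have hAB : h s s - g = 0 ∨ h t t - g = 0 ∨ ∑ u ∈ B, c u - ∑ u ∈ A, c u ≠ 0 := by
      by_contra! H
      have hEq : B = A := hc (sub_eq_zero.1 H.2.2)
      have hs : s ∈ A := by simpa [A] using sub_pos.1 (lt_of_le_of_ne hgs (Ne.symm H.1))
      have hs' : s ∈ B := hEq ▸ hs
      simp [B, hsymm t s, ← hg] at hs'
    rcases hAB with H | H | H
    · simp only [H, mul_zero, if_true]
      split_ifs <;> positivity
    · simp only [H, mul_zero, if_true]
      split_ifs <;> positivity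
    · have := sq_pos_of_ne_zero H
      split_ifs <;> positivity
  · rw [UpperHalfPlane.cosh_dist']
    have e1 : Real.exp (-(r * (2 * (h s s - g))))
        = Real.exp (-(r * h s s)) ^ 2 * Real.exp (r * g) ^ 2 := by
      rw [← Real.exp_nat_mul, ← Real.exp_nat_mul, ← Real.exp_add]; push_cast; ring_nf
    have e2 : Real.exp (-(r * (2 * (h t t - g))))
        = Real.exp (-(r * h t t)) ^ 2 * Real.exp (r * g) ^ 2 := by
      rw [← Real.exp_nat_mul, ← Real.exp_nat_mul, ← Real.exp_add]; push_cast; ring_nf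
    have e3 : Real.exp (-(r * (h s s + h t t - 2 * g)))
        = Real.exp (-(r * h s s)) * Real.exp (-(r * h t t)) * Real.exp (r * g) ^ 2 := by
      rw [← Real.exp_nat_mul, ← Real.exp_add, ← Real.exp_add]; push_cast; ring_nf
    rw [e1, e2, e3]
    change _ = ((X s r - X t r) ^ 2 + Real.exp (-(r * h s s)) ^ 2 + Real.exp (-(r * h t t)) ^ 2) /
      (2 * Real.exp (-(r * h s s)) * Real.exp (-(r * h t t))) * _
    have p1 := (Real.exp_pos (-(r * h s s))).ne'
    have p2 := (Real.exp_pos (-(r * h t t))).ne'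
    field_simp

/-! ### Gromov products in real trees -/

/-- The Gromov product of `x` and `y` with respect to the base point `p`. -/
noncomputable def gromovProduct {T : Type*} [MetricSpace T] (p x y : T) : ℝ :=
  (dist p x + dist p y - dist x y) / 2

theorem gromovProduct_comm {T : Type*} [MetricSpace T] (p x y : T) :
    gromovProduct p x y = gromovProduct p y x := by
  simp only [gromovProduct, dist_comm x y]; ring

theorem gromovProduct_self {T : Type*} [MetricSpace T] (p x : T) :
    gromovProduct p x x = dist p x := by
  simp [gromovProduct]

theorem gromovProduct_le_left {T : Type*} [MetricSpace T] (p x y : T) :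
    gromovProduct p x y ≤ dist p x := by
  have := dist_triangle p x y
  simp only [gromovProduct]; linarith

theorem gromovProduct_le_right {T : Type*} [MetricSpace T] (p x y : T) :
    gromovProduct p x y ≤ dist p y := by
  rw [gromovProduct_comm]; exact gromovProduct_le_left p y x

theorem gromovProduct_nonneg {T : Type*} [MetricSpace T] (p x y : T) :
    0 ≤ gromovProduct p x y := by
  have := dist_triangle_left x y p
  simp only [gromovProduct]; linarith

theorem IsGeodesicSegment.dist_add_dist {T : Type*} [MetricSpace T] {x y z : T} {s : Set T}
    (hs : IsGeodesicSegment x y s) (hz : z ∈ s) : dist x z + dist z y = dist x y := by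
  obtain ⟨g, hg, h0, h1, rfl⟩ := hs
  obtain ⟨q, hq, rfl⟩ := hz
  have e0 := hg 0 ⟨le_rfl, dist_nonneg⟩ q hq
  have e1 := hg q hq _ ⟨dist_nonneg, le_rfl⟩
  rw [h0, zero_sub, abs_neg, abs_of_nonneg hq.1] at e0
  rw [h1, abs_sub_comm, abs_of_nonneg (sub_nonneg.2 hq.2)] at e1
  linarith

/-- `g` parametrizes a geodesic segment from `x` to `y` by arc length. -/
structure IsGeodesicPath {T : Type*} [MetricSpace T] (x y : T) (g : ℝ → T) : Prop where
  dist_eq : ∀ u ∈ Set.Icc (0 : ℝ) (dist x y), ∀ v ∈ Set.Icc (0 : ℝ) (dist x y),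
    dist (g u) (g v) = |u - v|
  source : g 0 = x
  target : g (dist x y) = y

namespace IsGeodesicPath

variable {T : Type*} [MetricSpace T] {x y : T} {g : ℝ → T}

theorem dist_source (hg : IsGeodesicPath x y g) {u : ℝ} (hu : u ∈ Set.Icc (0 : ℝ) (dist x y)) :
    dist x (g u) = u := by
  have := hg.dist_eq 0 ⟨le_rfl, dist_nonneg⟩ u hu
  rwa [hg.source, zero_sub, abs_neg, abs_of_nonneg hu.1] at this

theorem dist_target (hg : IsGeodesicPath x y g) {u : ℝ} (hu : u ∈ Set.Icc (0 : ℝ) (dist x y)) :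
    dist (g u) y = dist x y - u := by
  have := hg.dist_eq u hu _ ⟨dist_nonneg, le_rfl⟩
  rwa [hg.target, abs_sub_comm, abs_of_nonneg (sub_nonneg.2 hu.2)] at this

theorem continuousOn (hg : IsGeodesicPath x y g) :
    ContinuousOn g (Set.Icc (0 : ℝ) (dist x y)) := by
  refine (LipschitzOnWith.of_dist_le_mul (K := 1) fun u hu v hv => ?_).continuousOn
  rw [hg.dist_eq u hu v hv, NNReal.coe_one, one_mul, Real.dist_eq]

theorem isGeodesicSegment_initial (hg : IsGeodesicPath x y g) {u : ℝ}
    (hu : u ∈ Set.Icc (0 : ℝ) (dist x y)) :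
    IsGeodesicSegment x (g u) (g '' Set.Icc 0 u) := by
  refine ⟨g, ?_, hg.source, ?_, ?_⟩ <;> rw [hg.dist_source hu]
  intro v hv w hw
  exact hg.dist_eq v ⟨hv.1, hv.2.trans hu.2⟩ w ⟨hw.1, hw.2.trans hu.2⟩

theorem isGeodesicSegment_final (hg : IsGeodesicPath x y g) {u : ℝ}
    (hu : u ∈ Set.Icc (0 : ℝ) (dist x y)) :
    IsGeodesicSegment (g u) y (g '' Set.Icc u (dist x y)) := by
  refine ⟨fun v => g (u + v), ?_, by simp, ?_, ?_⟩ <;> rw [hg.dist_target hu]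
  · intro v hv w hw
    rw [hg.dist_eq _ ⟨by linarith [hu.1, hv.1], by linarith [hv.2]⟩ _
      ⟨by linarith [hu.1, hw.1], by linarith [hw.2]⟩]
    congr 1; ring
  · beta_reduce
    rw [add_sub_cancel, hg.target]
  · rw [← Set.image_image g (fun v => u + v), Set.image_const_add_Icc]
    simp

theorem isGeodesicSegment_final_symm (hg : IsGeodesicPath x y g) {u : ℝ}
    (hu : u ∈ Set.Icc (0 : ℝ) (dist x y)) :
    IsGeodesicSegment y (g u) (g '' Set.Icc u (dist x y)) := by
  refine ⟨fun v => g (dist x y - v), ?_, by simp [hg.target], ?_, ?_⟩ <;>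
    rw [dist_comm y, hg.dist_target hu]
  · intro v hv w hw
    rw [hg.dist_eq _ ⟨by linarith [hv.2, hu.1], by linarith [hv.1]⟩ _
      ⟨by linarith [hw.2, hu.1], by linarith [hw.1]⟩, abs_sub_comm]
    congr 1; ring
  · beta_reduce
    rw [sub_sub_cancel]
  · rw [← Set.image_image g (fun v => dist x y - v), Set.image_const_sub_Icc]
    simp

/-- The Gromov product bounds every level at which two geodesics from `p` meet. -/
theorem le_gromovProduct {p x y : T} {f g : ℝ → T}
    (hf : IsGeodesicPath p x f) (hg : IsGeodesicPath p y g) {u : ℝ} (hu : 0 ≤ u)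
    (hux : u ≤ dist p x) (huy : u ≤ dist p y) (h : f u = g u) : u ≤ gromovProduct p x y := by
  have e1 := hf.dist_target ⟨hu, hux⟩
  have e2 := hg.dist_target ⟨hu, huy⟩
  have := dist_triangle_left x y (f u)
  rw [← h] at e2
  simp only [gromovProduct]; linarith

end IsGeodesicPath

/-! ### Branching of geodesics in a real tree -/

namespace IsRealTree

variable {T : Type*} [MetricSpace T]

theorem exists_isGeodesicPath (hT : IsRealTree T) (x y : T) : ∃ g, IsGeodesicPath x y g := by
  rcases eq_or_ne x y with rfl | hxy
  · refine ⟨fun _ => x, fun u hu v hv => ?_, rfl, rfl⟩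
    rw [dist_self, Set.Icc_self, Set.mem_singleton_iff] at hu hv
    simp [hu, hv]
  · obtain ⟨s, ⟨g, h1, h2, h3, -⟩, -⟩ := hT.existsUnique_segment x y hxy
    exact ⟨g, h1, h2, h3⟩

theorem isGeodesicSpace (hT : IsRealTree T) : IsGeodesicSpace T := fun x y =>
  let ⟨g, hg⟩ := hT.exists_isGeodesicPath x y
  ⟨_, g, hg.dist_eq, hg.source, hg.target, rfl⟩

/-- Geodesics from a common point that meet at a level agree up to that level. -/
theorem eq_of_le (hT : IsRealTree T) {p x y : T} {f g : ℝ → T} (hf : IsGeodesicPath p x f)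
    (hg : IsGeodesicPath p y g) {u v : ℝ} (hux : u ≤ dist p x) (huy : u ≤ dist p y)
    (h : f u = g u) (hv0 : 0 ≤ v) (hvu : v ≤ u) : f v = g v := by
  have hu0 := hv0.trans hvu
  -- Uniqueness of segments is available only for distinct endpoints, so level 0 is treated apart.
  rcases hu0.eq_or_lt with rfl | hpos
  · rw [le_antisymm hvu hv0, h]
  have hne : p ≠ f u := fun e => hpos.ne (by rw [← hf.dist_source ⟨hu0, hux⟩, ← e, dist_self])
  have hseg : f '' Set.Icc 0 u = g '' Set.Icc 0 u :=
    (hT.existsUnique_segment p (f u) hne).unique (hf.isGeodesicSegment_initial ⟨hu0, hux⟩)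
      (h ▸ hg.isGeodesicSegment_initial ⟨hu0, huy⟩)
  obtain ⟨w, hw, hwv⟩ : f v ∈ g '' Set.Icc 0 u := hseg ▸ Set.mem_image_of_mem f ⟨hv0, hvu⟩
  have h1 := hf.dist_source ⟨hv0, hvu.trans hux⟩
  have h2 := hg.dist_source ⟨hw.1, hw.2.trans huy⟩
  rw [hwv, h1] at h2
  rw [← hwv, h2]

/-- Two geodesics from `p` agree at the level given by the Gromov product. -/
theorem eq_gromovProduct (hT : IsRealTree T) {p x y : T} {f g : ℝ → T}
    (hf : IsGeodesicPath p x f) (hg : IsGeodesicPath p y g) :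
    f (gromovProduct p x y) = g (gromovProduct p x y) := by
  set b := min (dist p x) (dist p y) with hb
  let S : Set ℝ := {u ∈ Set.Icc 0 b | dist (f u) (g u) = 0}
  have hSc : IsClosed S := by
    have hfb := hf.continuousOn.mono (Set.Icc_subset_Icc_right (min_le_left _ _ : b ≤ _))
    have hgb := hg.continuousOn.mono (Set.Icc_subset_Icc_right (min_le_right _ _ : b ≤ _))
    exact (continuous_dist.comp_continuousOn (hfb.prodMk hgb)).preimage_isClosed_of_isClosed isClosed_Icc (isClosed_singleton (x := 0))
  have hScomp : IsCompact S := isCompact_Icc.of_isClosed_subset hSc fun u hu => hu.1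
  have hS0 : (0 : ℝ) ∈ S :=
    ⟨⟨le_rfl, le_min dist_nonneg dist_nonneg⟩, by rw [hf.source, hg.source, dist_self]⟩
  -- Beyond the last common level `m` the geodesics are disjoint, since a common point has the same
  -- level on both. The union axiom then makes the path from `x` through `f m` to `y` geodesic,
  -- which forces `m` to be the Gromov product.
  obtain ⟨m, ⟨hm, hmeq⟩, hmax⟩ := hScomp.exists_isGreatest ⟨0, hS0⟩
  have hmeq := dist_eq_zero.1 hmeq
  have hmx : m ∈ Set.Icc 0 (dist p x) := ⟨hm.1, hm.2.trans (min_le_left _ _)⟩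
  have hmy : m ∈ Set.Icc 0 (dist p y) := ⟨hm.1, hm.2.trans (min_le_right _ _)⟩
  have hinter : f '' Set.Icc m (dist p x) ∩ g '' Set.Icc m (dist p y) = {f m} := by
    refine Set.Subset.antisymm ?_ ?_
    · rintro _ ⟨⟨v, hv, rfl⟩, w, hw, hwv⟩
      have h1 := hf.dist_source ⟨hm.1.trans hv.1, hv.2⟩
      have h2 := hg.dist_source ⟨hm.1.trans hw.1, hw.2⟩
      rw [hwv, h1] at h2
      subst h2
      have : v ≤ m := hmax ⟨⟨hm.1.trans hv.1, le_min hv.2 hw.2⟩, dist_eq_zero.2 hwv.symm⟩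
      rw [le_antisymm this hv.1, Set.mem_singleton_iff]
    · rw [Set.singleton_subset_iff]
      exact ⟨⟨m, ⟨le_rfl, hmx.2⟩, rfl⟩, m, ⟨le_rfl, hmy.2⟩, hmeq.symm⟩
  have hseg := hT.union_segment x (f m) y _ _ (hf.isGeodesicSegment_final_symm hmx)
    (hmeq ▸ hg.isGeodesicSegment_final hmy) hinter
  have hd := hseg.dist_add_dist (Or.inl ⟨m, ⟨le_rfl, hmx.2⟩, rfl⟩)
  have e1 := hf.dist_target hmx
  have e2 := hg.dist_target hmy
  rw [dist_comm] at e1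
  rw [← hmeq] at e2
  have : gromovProduct p x y = m := by
    simp only [gromovProduct]; linarith
  rw [this, hmeq]

/-- Up to the smaller level, the geodesic to `y` agrees with those to `x` and to `z`, so these two
agree there as well. -/
theorem min_gromovProduct_le (hT : IsRealTree T) (p x y z : T) :
    min (gromovProduct p x y) (gromovProduct p y z) ≤ gromovProduct p x z := by
  obtain ⟨f, hf⟩ := hT.exists_isGeodesicPath p x
  obtain ⟨g, hg⟩ := hT.exists_isGeodesicPath p y
  obtain ⟨k, hk⟩ := hT.exists_isGeodesicPath p z
  set u := min (gromovProduct p x y) (gromovProduct p y z)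
  have hu : 0 ≤ u := le_min (gromovProduct_nonneg _ _ _) (gromovProduct_nonneg _ _ _)
  have h1 : u ≤ gromovProduct p x y := min_le_left _ _
  have h2 : u ≤ gromovProduct p y z := min_le_right _ _
  refine hf.le_gromovProduct hk hu (h1.trans (gromovProduct_le_left _ _ _))
    (h2.trans (gromovProduct_le_right _ _ _)) ?_
  rw [hT.eq_of_le hf hg (gromovProduct_le_left _ _ _) (gromovProduct_le_right _ _ _)
    (hT.eq_gromovProduct hf hg) hu h1]
  exact hT.eq_of_le hg hk (gromovProduct_le_left _ _ _) (gromovProduct_le_right _ _ _)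
    (hT.eq_gromovProduct hg hk) hu h2

end IsRealTree

theorem corollary3p10 {T : Type*} [MetricSpace T] (hT : IsRealTree T)
    (hV : (realTreeVertices T).Countable) :
    IsAsymptoticSubcone T UpperHalfPlane := by
  refine ⟨hT.isGeodesicSpace, fun F hF => ?_⟩
  have hε : Tendsto (fun i : ℕ => ((i : ℝ) + 1)) atTop atTop :=
    tendsto_natCast_atTop_atTop.atTop_add tendsto_const_nhds
  refine ⟨fun i => ((i : ℝ) + 1)⁻¹, fun i => by positivity, tendsto_inv_atTop_zero.comp hε, ?_⟩
  rcases F.eq_empty_or_nonempty with rfl | ⟨p, -⟩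
  · exact ⟨fun t => t.2.elim, fun t => t.2.elim⟩
  have : Finite F := hF
  obtain ⟨z, hz⟩ := exists_upperHalfPlane_of_ultrametric
    (fun s t : F => gromovProduct p (s : T) t) (fun s t => gromovProduct_comm _ _ _)
    (fun s r t => hT.min_gromovProduct_le _ _ _ _)
  -- The scale `r = i + 1` is the inverse of the chosen `ε i`; the shift keeps it positive at `i =
  -- 0`.
  refine ⟨fun t i => z t (i + 1), fun s t => ?_⟩
  have hd : gromovProduct p (s : T) s + gromovProduct p (t : T) t - 2 * gromovProduct p (s : T) t
      = dist s t := by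
    rw [gromovProduct_self, gromovProduct_self, gromovProduct, Subtype.dist_eq]; ring
  exact hd ▸ (hz s t).comp hε
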